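/- Let $n\ge 1$ and let $\mathbf a=(a_1,\dots,a_n)\in\mathbb R^n$ have non-negative entries, not all zero. For a real symmetric $n\times n$ matrix $X$ with eigenvalues $\lambda_1(X)\le\dots\le\lambda_n(X)$ put $\mathcal M_{\mathbf a}(X)=\sum_{i=1}^n a_i\lambda_i(X)$. Write $|\mathbf a|=a_1+\dots+a_n$, $\tilde a=|\mathbf a|/n$, $a^*=\min(a_1,a_n)$, $\hat a_1=|\mathbf a|-a_1$, $\hat a_n=|\mathbf a|-a_n$. Assume $a_1\ge\hat a_1$ or $a_n\ge\hat a_n$, and put $$\alpha=\max\bigl(1-\hat a_1/a_1,\ 1-\hat a_n/a_n\bigr)\in[0,1],$$ where a term with zero denominator is read as $-\infty$. Let $\Omega\subset\mathbb R^n$ be a bounded domain, let $f$ be continuous and bounded in $\Omega$, and let $u\in C(\overline\Omega)$ be a viscosity solution of $\mathcal M_{\mathbf a}(D^2u)=f$ in $\Omega$ with $u=g$ on $\partial\Omega$. Assume (S) for some $R>0$: for every $y\in\partial\Omega$ there is a ball $B_R$ of radius $R$ with $y\in\partial B_R$ and $\overline\Omega\subset\overline B_R$. Let $[h]_{\beta,D}=\sup_{x\ne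 y\in D}|h(x)-h(y)|/|x-y|^\beta$ and $\|h\|_{C^\beta(D)}=\sup_D|h|+[h]_{\beta,D}$. Let $\|g\|_{C^{1,\beta}(\partial\Omega)}$ be the infimum of $\sup_\Omega|G|+\sup_\Omega|DG|+[DG]_{\beta,\Omega}$ over all extensions $G\in C^{1,\beta}(\overline\Omega)$ of $g$; $g\in C^{1,\beta}(\partial\Omega)$ means that such an extension exists (for $\beta=0$, $C^{1,0}(\overline\Omega)=C^1(\overline\Omega)$). General estimates. (i) If $g\in C^\beta(\partial\Omega)$ with $\beta\in(0,1]$, then with $\gamma=\min(\alpha,\beta/2)$ we have $u\in C^\gamma(\overline\Omega)$ and $$[u]_{\gamma,\Omega}\le C\bigl(\|g\|_{C^\beta(\partial\Omega)}+\|f\|_{L^\infty(\Omega)}\bigr),$$ where $C>0$ depends only on $n,a^*,\tilde a,R,\beta$. (ii) If in addition $\Omega$ has a uniform Lipschitz boundary with Lipschitz constant $L$, and $g\in C^{1,\beta}(\partial\Omega)$ with $\beta\in[0,1)$, then with $\gamma=\min(\alpha,(1+\beta)/2)$ we have $u\in C^\gamma(\overline\Omega)$ and $$[u]_{\gamma,\Omega}\le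 C\bigl(\|g\|_{C^{1,\beta}(\partial\Omega)}+\|f\|_{L^\infty(\Omega)}\bigr),$$ where $C>0$ depends only on $n,a^*,\tilde a,R,L,\beta$. Estimates with exponent $\alpha$. (i$'$) If $\alpha\in(0,1/2]$ and $g\in C^{2\alpha}(\partial\Omega)$, then $u\in C^\alpha(\overline\Omega)$ and $$[u]_{\alpha,\Omega}\le C\bigl(\|g\|_{C^{2\alpha}(\partial\Omega)}+\|f\|_{L^\infty(\Omega)}\bigr),$$ where $C>0$ depends only on $n,a_1,\hat a_1,a_n,\hat a_n,\tilde a,R,\alpha$. (ii$'$) If $\alpha\in[1/2,1]$, $\Omega$ in addition has a uniform Lipschitz boundary with Lipschitz constant $L$, and $g\in C^{1,2\alpha-1}(\partial\Omega)$, then $$[u]_{\alpha,\Omega}\le C\bigl(\|g\|_{C^{1,2\alpha-1}(\partial\Omega)}+\|f\|_{L^\infty(\Omega)}\bigr),$$ where $C>0$ depends only on $n,a_1,\hat a_1,a_n,\hat a_n,\tilde a,R,\alpha,L$. -/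

import Mathlib

open MeasureTheory Set Topology
open scoped NNReal ENNReal

noncomputable section

/-- `ℝⁿ` with its Euclidean norm. -/
abbrev Rn (n : ℕ) : Type := EuclideanSpace ℝ (Fin n)

/-! ### Weighted partial trace operators (the dimension is `n = m + 1 ≥ 1`) -/

/-- The `i`-th eigenvalue of a real symmetric matrix, in increasing order and with multiplicity
(Mathlib's `eigenvalues₀` lists them in decreasing order). -/
def eigenvalueIncr {n : ℕ} {X : Matrix (Fin n) (Fin n) ℝ} (hX : X.IsHermitian) (i : Fin n) : ℝ :=
  hX.eigenvalues₀ (Fin.cast (Fintype.card_fin n).symm i.rev)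

/-- `M_a(X) = a₁ λ₁(X) + ⋯ + aₙ λₙ(X)`. -/
def weightedTrace {n : ℕ} (a : Fin n → ℝ) {X : Matrix (Fin n) (Fin n) ℝ}
    (hX : X.IsHermitian) : ℝ :=
  ∑ i, a i * eigenvalueIncr hX i

/-- The weights of the class `𝒜̄`: non-negative, not all zero. -/
def IsWeight {n : ℕ} (a : Fin n → ℝ) : Prop :=
  (∀ i, 0 ≤ a i) ∧ ∃ j, 0 < a j

/-- `ã = (a₁ + ⋯ + aₙ) / n`. -/
def weightMean {m : ℕ} (a : Fin (m + 1) → ℝ) : ℝ := (∑ i, a i) / ((m : ℝ) + 1)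

/-- `a* = min(a₁, aₙ)`. -/
def weightStar {m : ℕ} (a : Fin (m + 1) → ℝ) : ℝ := min (a 0) (a (Fin.last m))

/-- The complement `â_j = |a| - a_j`, where `|a| = a₁ + ⋯ + aₙ`. -/
def weightHat {n : ℕ} (a : Fin n → ℝ) (j : Fin n) : ℝ := (∑ i, a i) - a j

/-- `a₁ ≥ â₁` or `aₙ ≥ âₙ`. -/
def IsAsymmetric {m : ℕ} (a : Fin (m + 1) → ℝ) : Prop :=
  weightHat a 0 ≤ a 0 ∨ weightHat a (Fin.last m) ≤ a (Fin.last m)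

/-- `max(1 - â₁/a₁, 1 - âₙ/aₙ)`; a term with zero denominator (and then positive numerator)
has the value `-∞`, so that it does not contribute to the maximum. -/
def asymmetryExponent {m : ℕ} (a : Fin (m + 1) → ℝ) : ℝ :=
  if a 0 = 0 then 1 - weightHat a (Fin.last m) / a (Fin.last m)
  else if a (Fin.last m) = 0 then 1 - weightHat a 0 / a 0
  else max (1 - weightHat a 0 / a 0) (1 - weightHat a (Fin.last m) / a (Fin.last m))

/-! ### Viscosity solutions -/

/-- The quadratic polynomial `u(x₀) + ⟨ξ, x - x₀⟩ + ½ ⟨X (x - x₀), x - x₀⟩`. -/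
def jetPoly {n : ℕ} (u : Rn n → ℝ) (x₀ ξ : Rn n) (X : Matrix (Fin n) (Fin n) ℝ) (x : Rn n) : ℝ :=
  u x₀ + inner ℝ ξ (x - x₀) + (1 / 2) * inner ℝ (Matrix.toEuclideanLin X (x - x₀)) (x - x₀)

/-- For symmetric `X`: `(ξ, X)` belongs to the second order superjet of `u` at `x₀`
relative to `O`. -/
def InSuperjet {n : ℕ} (O : Set (Rn n)) (u : Rn n → ℝ) (x₀ ξ : Rn n)
    (X : Matrix (Fin n) (Fin n) ℝ) : Prop :=
  ∀ ε > 0, ∀ᶠ x in 𝓝[O] x₀, u x ≤ jetPoly u x₀ ξ X x + ε * ‖x - x₀‖ ^ 2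

/-- For symmetric `X`: `(ξ, X)` belongs to the second order subjet of `u` at `x₀`
relative to `O`. -/
def InSubjet {n : ℕ} (O : Set (Rn n)) (u : Rn n → ℝ) (x₀ ξ : Rn n)
    (X : Matrix (Fin n) (Fin n) ℝ) : Prop :=
  ∀ ε > 0, ∀ᶠ x in 𝓝[O] x₀, jetPoly u x₀ ξ X x - ε * ‖x - x₀‖ ^ 2 ≤ u x

/-- `u` is a viscosity subsolution of `M_a(D²u) = f` in `O`. -/
def IsViscositySubsolution {n : ℕ} (a : Fin n → ℝ) (O : Set (Rn n)) (f u : Rn n → ℝ) : Prop :=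
  UpperSemicontinuousOn u O ∧
    ∀ x ∈ O, ∀ (ξ : Rn n) (X : Matrix (Fin n) (Fin n) ℝ) (hX : X.IsHermitian),
      InSuperjet O u x ξ X → f x ≤ weightedTrace a hX

/-- `u` is a viscosity supersolution of `M_a(D²u) = f` in `O`. -/
def IsViscositySupersolution {n : ℕ} (a : Fin n → ℝ) (O : Set (Rn n)) (f u : Rn n → ℝ) : Prop :=
  LowerSemicontinuousOn u O ∧
    ∀ x ∈ O, ∀ (ξ : Rn n) (X : Matrix (Fin n) (Fin n) ℝ) (hX : X.IsHermitian),
      InSubjet O u x ξ X → weightedTrace a hX ≤ f x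

/-- `Ω` is a bounded domain, `f` is continuous and bounded in `Ω`, and `u ∈ C(Ω̄)` is a viscosity
solution of `M_a(D²u) = f` in `Ω` with `u = g` on `∂Ω`. -/
structure IsDirichletSolution {n : ℕ} (a : Fin n → ℝ) (Ω : Set (Rn n)) (f g u : Rn n → ℝ) :
    Prop where
  isOpen : IsOpen Ω
  isConnected : IsConnected Ω
  isBounded : Bornology.IsBounded Ω
  continuousOn_rhs : ContinuousOn f Ω
  bounded_rhs : ∃ M : ℝ, ∀ x ∈ Ω, |f x| ≤ M
  continuousOn : ContinuousOn u (closure Ω)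
  subsolution : IsViscositySubsolution a Ω f u
  supersolution : IsViscositySupersolution a Ω f u
  boundary : ∀ x ∈ frontier Ω, u x = g x

/-! ### Conditions on the domain -/

/-- Condition (S): for every `y ∈ ∂Ω` there is a ball `B_R` of radius `R` with `y ∈ ∂B_R` and
`Ω̄ ⊆ B̄_R`. -/
def UniformExteriorSphere {n : ℕ} (Ω : Set (Rn n)) (R : ℝ) : Prop :=
  ∀ y ∈ frontier Ω, ∃ c : Rn n,
    y ∈ Metric.sphere c R ∧ closure Ω ⊆ Metric.closedBall c R

/-- Uniform Lipschitz boundary with constant `L`: in a ball of fixed radius around each boundary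
point, `Ω` is the strict epigraph, in some direction `ν`, of an `L`-Lipschitz function of the
variables orthogonal to `ν`. -/
def UniformLipschitzBoundary {n : ℕ} (Ω : Set (Rn n)) (L : ℝ≥0) : Prop :=
  ∃ r > 0, ∀ y ∈ frontier Ω, ∃ (ν : Rn n) (φ : Rn n → ℝ),
    ‖ν‖ = 1 ∧ LipschitzWith L φ ∧ (∀ (x : Rn n) (s : ℝ), φ (x + s • ν) = φ x) ∧
    Ω ∩ Metric.ball y r = {x | x ∈ Metric.ball y r ∧ φ x < inner ℝ ν x}

/-! ### Hölder norms -/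

/-- `sup_D ‖h‖`. -/
def supNormOn {n : ℕ} {F : Type} [NormedAddCommGroup F] (D : Set (Rn n)) (h : Rn n → F) : ℝ≥0∞ :=
  ⨆ x ∈ D, ‖h x‖ₑ

/-- The Hölder seminorm `[h]_{β, D}`, for an exponent `β ≥ 0`. -/
def holderSeminorm {n : ℕ} {F : Type} [NormedAddCommGroup F] (β : ℝ) (D : Set (Rn n))
    (h : Rn n → F) : ℝ≥0∞ :=
  eHolderNorm β.toNNReal (fun x : D => h x)

/-- The norm of `C^β(D)`. -/
def holderNorm {n : ℕ} (β : ℝ) (D : Set (Rn n)) (h : Rn n → ℝ) : ℝ≥0∞ :=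
  supNormOn D h + holderSeminorm β D h

/-- `h ∈ C^β(D)`, for compact `D` and continuous `h`. -/
def HolderOn {n : ℕ} (β : ℝ) (D : Set (Rn n)) (h : Rn n → ℝ) : Prop :=
  ContinuousOn h D ∧ holderNorm β D h < ∞

/-- `G`, with gradient `V`, is a `C¹(Ω̄)` extension of the boundary function `g`. -/
structure IsC1Extension {n : ℕ} (Ω : Set (Rn n)) (g G : Rn n → ℝ) (V : Rn n → Rn n) : Prop where
  continuousOn : ContinuousOn G (closure Ω)
  continuousOn_grad : ContinuousOn V (closure Ω)
  hasGradientAt : ∀ x ∈ Ω, HasGradientAt G (V x) x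
  eq_boundary : ∀ x ∈ frontier Ω, G x = g x

/-- The norm of `C^{1,β}(∂Ω)`, that is the infimum of
`‖G‖_{C^{1,β}(Ω̄)} = sup |G| + sup |DG| + [DG]_β` over the extensions `G` of `g` to `Ω̄`;
it is `∞` if there is no extension of class `C^{1,β}(Ω̄)`. -/
def boundaryC1HolderNorm {n : ℕ} (β : ℝ) (Ω : Set (Rn n)) (g : Rn n → ℝ) : ℝ≥0∞ :=
  ⨅ (G : Rn n → ℝ) (V : Rn n → Rn n) (_ : IsC1Extension Ω g G V),
    supNormOn (closure Ω) G + supNormOn (closure Ω) V + holderSeminorm β (closure Ω) V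

/-- `‖f‖_{L^∞(Ω)}`. -/
def linftyNorm {n : ℕ} (Ω : Set (Rn n)) (f : Rn n → ℝ) : ℝ≥0∞ :=
  eLpNorm f ∞ (volume.restrict Ω)

end

/-! Every estimate is a direct comparison, with no doubling of variables. Suppose `γ ≤ 1 - â₁/a₁`;
the other case is the same for `-u`. The Hessian of `|x - y|^γ` has the radial eigenvalue `c(γ - 1)`
and otherwise `c ≥ 0`, so its weighted trace is at most `c(a₁(γ - 1) + â₁) ≤ 0`. Hence, if `k|a| >
sup |f|`, the function `u(y) + A|x - y|^γ - (k/2)|x - y|²` is a strict supersolution off `y` and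
cannot touch `u` from above inside `Ω` (`holder_estimate_of_jets`). Then `u - w`, with `w` this
function, has its maximum at `y`, where it is harmless, or on `∂Ω`.

At a boundary point `x` a bound of `u` from below is needed (`boundary_lower_bound`). Let `c` now be
the centre of the enclosing ball. On that ball `|z - x|²` is dominated by the affine function `t(z)
= 2⟨x - c, x - z⟩`. Data with expansion error `H|z - x|^(2σ)` therefore lie above a convex function
containing `-H t^σ`; adding `(k/2)(|z - c|² - R²)` makes it a strict subsolution. Since `t` is only
of order `|z - x|`, the exponent `2σ` on the boundary becomes `σ` inside. For `g ∈ C^β` one has `σ =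
β/2` with zero slope; for `g ∈ C^{1,β}`, `σ = (1 + β)/2` with slope the gradient of an extension,
whose Taylor formula holds because condition (S) makes `Ω` convex. -/

noncomputable section

/-! ### Bounds for weighted traces -/

section WeightedTrace

variable {m : ℕ} {X : Matrix (Fin (m + 1)) (Fin (m + 1)) ℝ}

theorem exists_eigenvector_eigenvalueIncr {n : ℕ} {X : Matrix (Fin n) (Fin n) ℝ}
    (hX : X.IsHermitian) (i : Fin n) :
    ∃ v : Rn n, ‖v‖ = 1 ∧ Matrix.toEuclideanLin X v = eigenvalueIncr hX i • v := by
  have hT := Matrix.isSymmetric_toEuclideanLin_iff.mpr hX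
  refine ⟨hT.eigenvectorBasis finrank_euclideanSpace (Fin.cast (Fintype.card_fin n).symm i.rev),
    OrthonormalBasis.norm_eq_one _ _, ?_⟩
  exact hT.apply_eigenvectorBasis finrank_euclideanSpace _

/-- Parseval in an orthonormal eigenbasis: `p i` is the squared coordinate of `e`. For a unit vector
the quadratic form is thus an average of eigenvalues, hence lies between the extreme ones. -/
theorem inner_toEuclideanLin_self_eq_sum {n : ℕ} {X : Matrix (Fin n) (Fin n) ℝ}
    (hX : X.IsHermitian) (e : Rn n) :
    ∃ p : Fin (Fintype.card (Fin n)) → ℝ, (∀ i, 0 ≤ p i) ∧ ∑ i, p i = ‖e‖ ^ 2 ∧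
      inner ℝ (Matrix.toEuclideanLin X e) e = ∑ i, hX.eigenvalues₀ i * p i := by
  have hT := Matrix.isSymmetric_toEuclideanLin_iff.mpr hX
  let b := hT.eigenvectorBasis finrank_euclideanSpace
  refine ⟨fun i => inner ℝ e (b i) * inner ℝ (b i) e, fun i => ?_, ?_, ?_⟩
  · simp only [real_inner_comm e]
    exact mul_self_nonneg _
  · rw [b.sum_inner_mul_inner, real_inner_self_eq_norm_sq]
  · rw [← b.sum_inner_mul_inner]
    refine Finset.sum_congr rfl fun i _ => ?_
    have h := hT.apply_eigenvectorBasis finrank_euclideanSpace i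
    rw [hT e (b i), h, real_inner_smul_right]
    simp [Matrix.IsHermitian.eigenvalues₀, b, mul_assoc]

theorem eigenvalueIncr_le {n : ℕ} {X : Matrix (Fin n) (Fin n) ℝ} (hX : X.IsHermitian) {M : ℝ}
    (hM : ∀ v : Rn n, inner ℝ (Matrix.toEuclideanLin X v) v ≤ M * ‖v‖ ^ 2) (i : Fin n) :
    eigenvalueIncr hX i ≤ M := by
  obtain ⟨v, hv, h⟩ := exists_eigenvector_eigenvalueIncr hX i
  have := hM v
  rwa [h, real_inner_smul_left, real_inner_self_eq_norm_sq, hv, one_pow, mul_one, mul_one] at this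

theorem le_eigenvalueIncr {n : ℕ} {X : Matrix (Fin n) (Fin n) ℝ} (hX : X.IsHermitian) {M : ℝ}
    (hM : ∀ v : Rn n, M * ‖v‖ ^ 2 ≤ inner ℝ (Matrix.toEuclideanLin X v) v) (i : Fin n) :
    M ≤ eigenvalueIncr hX i := by
  obtain ⟨v, hv, h⟩ := exists_eigenvector_eigenvalueIncr hX i
  have := hM v
  rwa [h, real_inner_smul_left, real_inner_self_eq_norm_sq, hv, one_pow, mul_one, mul_one] at this

theorem eigenvalueIncr_zero_le (hX : X.IsHermitian) {q : ℝ} {e : Rn (m + 1)} (he : ‖e‖ = 1)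
    (hq : inner ℝ (Matrix.toEuclideanLin X e) e ≤ q) : eigenvalueIncr hX 0 ≤ q := by
  obtain ⟨p, hp, hs, h⟩ := inner_toEuclideanLin_self_eq_sum hX e
  rw [he, one_pow] at hs
  calc eigenvalueIncr hX 0 = ∑ i, eigenvalueIncr hX 0 * p i := by
        rw [← Finset.mul_sum, hs, mul_one]
    _ ≤ ∑ i, hX.eigenvalues₀ i * p i := by
        refine Finset.sum_le_sum fun i _ => mul_le_mul_of_nonneg_right ?_ (hp i)
        -- `eigenvalues₀` decreases, so the smallest eigenvalue sits at its last index.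
        refine hX.eigenvalues₀_antitone ?_
        have := i.2
        simp only [Fintype.card_fin] at this
        rw [Fin.le_def]
        simp
        omega
    _ ≤ q := h ▸ hq

theorem le_eigenvalueIncr_last (hX : X.IsHermitian) {q : ℝ} {e : Rn (m + 1)} (he : ‖e‖ = 1)
    (hq : q ≤ inner ℝ (Matrix.toEuclideanLin X e) e) : q ≤ eigenvalueIncr hX (Fin.last m) := by
  obtain ⟨p, hp, hs, h⟩ := inner_toEuclideanLin_self_eq_sum hX e
  rw [he, one_pow] at hs
  calc q ≤ ∑ i, hX.eigenvalues₀ i * p i := h ▸ hq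
    _ ≤ ∑ i, eigenvalueIncr hX (Fin.last m) * p i := by
        refine Finset.sum_le_sum fun i _ => mul_le_mul_of_nonneg_right ?_ (hp i)
        refine hX.eigenvalues₀_antitone ?_
        rw [Fin.le_def]
        simp
    _ = eigenvalueIncr hX (Fin.last m) := by
        rw [← Finset.mul_sum, hs, mul_one]

theorem weightHat_eq_sum_erase {n : ℕ} (a : Fin n → ℝ) (j : Fin n) :
    weightHat a j = ∑ i ∈ Finset.univ.erase j, a i := by
  rw [weightHat, ← Finset.add_sum_erase _ _ (Finset.mem_univ j)]
  ring

/-- One good direction controls only `λ₁`; all other eigenvalues get the crude bound `M`. This is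
why the dominance of a single extreme weight decides the exponent. -/
theorem weightedTrace_le {a : Fin (m + 1) → ℝ} (ha : ∀ i, 0 ≤ a i) (hX : X.IsHermitian)
    {M q : ℝ} (hM : ∀ v : Rn (m + 1), inner ℝ (Matrix.toEuclideanLin X v) v ≤ M * ‖v‖ ^ 2)
    {e : Rn (m + 1)} (he : ‖e‖ = 1) (hq : inner ℝ (Matrix.toEuclideanLin X e) e ≤ q) :
    weightedTrace a hX ≤ a 0 * q + weightHat a 0 * M := by
  rw [weightedTrace, ← Finset.add_sum_erase _ _ (Finset.mem_univ 0), weightHat_eq_sum_erase,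
    Finset.sum_mul]
  exact add_le_add (mul_le_mul_of_nonneg_left (eigenvalueIncr_zero_le hX he hq) (ha 0))
    (Finset.sum_le_sum fun i _ => mul_le_mul_of_nonneg_left (eigenvalueIncr_le hX hM i) (ha i))

theorem le_weightedTrace {a : Fin (m + 1) → ℝ} (ha : ∀ i, 0 ≤ a i) (hX : X.IsHermitian)
    {M q : ℝ} (hM : ∀ v : Rn (m + 1), M * ‖v‖ ^ 2 ≤ inner ℝ (Matrix.toEuclideanLin X v) v)
    {e : Rn (m + 1)} (he : ‖e‖ = 1) (hq : q ≤ inner ℝ (Matrix.toEuclideanLin X e) e) :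
    a (Fin.last m) * q + weightHat a (Fin.last m) * M ≤ weightedTrace a hX := by
  rw [weightedTrace, ← Finset.add_sum_erase _ _ (Finset.mem_univ (Fin.last m)),
    weightHat_eq_sum_erase, Finset.sum_mul]
  exact add_le_add (mul_le_mul_of_nonneg_left (le_eigenvalueIncr_last hX he hq) (ha _))
    (Finset.sum_le_sum fun i _ => mul_le_mul_of_nonneg_left (le_eigenvalueIncr hX hM i) (ha i))

end WeightedTrace

/-- The matrix `c (I - θ e ⊗ e) - k I`. -/
def radialHessian {n : ℕ} (c θ k : ℝ) (e : Rn n) : Matrix (Fin n) (Fin n) ℝ :=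
  (c - k) • (1 : Matrix (Fin n) (Fin n) ℝ) - (c * θ) • Matrix.vecMulVec e e

theorem radialHessian_isHermitian {n : ℕ} (c θ k : ℝ) (e : Rn n) :
    (radialHessian c θ k e).IsHermitian := by
  rw [radialHessian, Matrix.IsHermitian, Matrix.conjTranspose_eq_transpose_of_trivial]
  simp [Matrix.transpose_vecMulVec]

/-- Two instances matter: `θ = 2 - γ`, the Hessian of `A|x - y|^γ - (k/2)|x - y|²`, and
`radialHessian 0 0 (-k) 0`, which is `k I`. -/
theorem inner_radialHessian {n : ℕ} (c θ k : ℝ) (e v : Rn n) :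
    inner ℝ (Matrix.toEuclideanLin (radialHessian c θ k e) v) v =
      (c - k) * ‖v‖ ^ 2 - c * θ * (inner ℝ e v) ^ 2 := by
  have h : Matrix.toEuclideanLin (radialHessian c θ k e) v =
      (c - k) • v - (c * θ * inner ℝ e v) • e := by
    ext i
    simp [radialHessian, Matrix.toLpLin_apply,
      Matrix.vecMulVec_mulVec, PiLp.inner_apply, dotProduct, mul_comm, mul_assoc]
    ring
  rw [h, inner_sub_left, real_inner_smul_left, real_inner_smul_left, real_inner_self_eq_norm_sq]
  ring

/-! ### Second order expansion of powers of the distance -/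

/-- The difference `F` of the two sides has `F(s₀) = F'(s₀) = 0` and `F''(s₀) = 2ε > 0`, so `s₀` is
a local minimum. -/
theorem eventually_rpow_le_taylor (q : ℝ) {s₀ ε : ℝ} (hs : 0 < s₀) (hε : 0 < ε) :
    ∀ᶠ s in 𝓝 s₀, s ^ q ≤ s₀ ^ q + q * s₀ ^ (q - 1) * (s - s₀) +
      q * (q - 1) / 2 * s₀ ^ (q - 2) * (s - s₀) ^ 2 + ε * (s - s₀) ^ 2 := by
  set b := q * (q - 1) / 2 * s₀ ^ (q - 2) with hb
  let F : ℝ → ℝ := fun s => s₀ ^ q + q * s₀ ^ (q - 1) * (s - s₀) + b * (s - s₀) ^ 2 +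
    ε * (s - s₀) ^ 2 - s ^ q
  have h1 : ∀ s, 0 < s → HasDerivAt F
      (q * s₀ ^ (q - 1) + 2 * (b + ε) * (s - s₀) - q * s ^ (q - 1)) s := by
    intro s hs
    have hl : HasDerivAt (fun s => s - s₀) 1 s := (hasDerivAt_id s).sub_const s₀
    have := ((((hl.const_mul (q * s₀ ^ (q - 1))).const_add (s₀ ^ q)).add
      ((hl.pow 2).const_mul b)).add ((hl.pow 2).const_mul ε)).sub
      (Real.hasDerivAt_rpow_const (p := q) (Or.inl hs.ne'))
    convert! this using 1
    push_cast
    ring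
  have hd : deriv F =ᶠ[𝓝 s₀]
      fun s => q * s₀ ^ (q - 1) + 2 * (b + ε) * (s - s₀) - q * s ^ (q - 1) := by
    filter_upwards [lt_mem_nhds hs] with s hs using (h1 s hs).deriv
  have h2 : HasDerivAt (fun s => q * s₀ ^ (q - 1) + 2 * (b + ε) * (s - s₀) - q * s ^ (q - 1))
      (2 * ε) s₀ := by
    have hl : HasDerivAt (fun s => s - s₀) 1 s₀ := (hasDerivAt_id s₀).sub_const s₀
    have := ((hl.const_mul (2 * (b + ε))).const_add (q * s₀ ^ (q - 1))).sub
      ((Real.hasDerivAt_rpow_const (p := q - 1) (Or.inl hs.ne')).const_mul q)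
    convert! this using 1
    rw [hb, show q - 1 - 1 = q - 2 by ring]
    ring
  have hmin : IsLocalMin F s₀ := by
    refine isLocalMin_of_deriv_deriv_pos ?_ ?_ (h1 s₀ hs).continuousAt
    · rw [hd.deriv_eq, h2.deriv]
      positivity
    · rw [(h1 s₀ hs).deriv]
      ring
  filter_upwards [hmin] with s h
  have : F s₀ = 0 := by simp [F]
  rw [this] at h
  simpa [F] using h

theorem norm_rpow_eq_sq_rpow_half {n : ℕ} (γ : ℝ) (v : Rn n) : ‖v‖ ^ γ = (‖v‖ ^ 2) ^ (γ / 2) := by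
  rw [← Real.rpow_natCast, ← Real.rpow_mul (norm_nonneg _)]
  congr 1
  push_cast
  ring

theorem sq_two_mul_add_sq_le {w P r : ℝ} (hr : 0 ≤ r) (hr1 : r ≤ 1) (hw : |w| ≤ P * r) :
    (2 * w + r ^ 2) ^ 2 ≤ (2 * P + 1) ^ 2 * r ^ 2 := by
  have h := abs_le.1 hw
  have h2 : r ^ 2 ≤ r := by nlinarith
  rw [← mul_pow]
  refine sq_le_sq' ?_ ?_
  · linarith [sq_nonneg r]
  · linarith

theorem four_mul_sq_sub_le {w P r : ℝ} (hw : |w| ≤ P * r) :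
    4 * w ^ 2 - 4 * P * r ^ 3 ≤ (2 * w + r ^ 2) ^ 2 := by
  have h := mul_le_mul_of_nonneg_right (abs_le.1 hw).1 (sq_nonneg r)
  linarith [pow_nonneg (sq_nonneg r) 2]

/-- The scalar expansion with exponent `γ/2` is applied to `s = |x - y|²`, whose increment is
exactly `2w + r²` with `w = ⟨x₀ - y, x - x₀⟩` and `r = |x - x₀|`. -/
theorem eventually_norm_rpow_le {n : ℕ} {γ : ℝ} (hγ : 0 ≤ γ) (hγ2 : γ ≤ 2) {x₀ y : Rn n}
    (hxy : x₀ ≠ y) {ε : ℝ} (hε : 0 < ε) :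
    ∀ᶠ x in 𝓝 x₀, ‖x - y‖ ^ γ ≤ ‖x₀ - y‖ ^ γ +
      γ * ‖x₀ - y‖ ^ (γ - 2) * inner ℝ (x₀ - y) (x - x₀) +
      1 / 2 * (γ * ‖x₀ - y‖ ^ (γ - 2)) * (‖x - x₀‖ ^ 2 -
        (2 - γ) * (inner ℝ (‖x₀ - y‖⁻¹ • (x₀ - y)) (x - x₀)) ^ 2) + ε * ‖x - x₀‖ ^ 2 := by
  set p := x₀ - y with hp
  have hP : 0 < ‖p‖ := norm_pos_iff.2 (sub_ne_zero.2 hxy)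
  set P := ‖p‖
  set B := γ / 2 * (1 - γ / 2) / 2 * P ^ (γ - 4) with hB
  have hB0 : 0 ≤ B := by
    have : 0 ≤ 1 - γ / 2 := by linarith
    positivity
  -- Half of `ε` pays for the scalar error, since `(2w + r²)² ≤ (2P + 1)² r²` for `r ≤ 1`; the other
  -- half absorbs the cubic term `4BP r³`.
  set ε' := ε / 2 / (2 * P + 1) ^ 2 with hε'
  have hε'0 : 0 < ε' := by positivity
  have hc : Filter.Tendsto (fun x : Rn n => ‖x - y‖ ^ 2) (𝓝 x₀) (𝓝 (P ^ 2)) := by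
    have : Continuous (fun x : Rn n => ‖x - y‖ ^ 2) := by fun_prop
    exact this.tendsto x₀
  have hc2 : Filter.Tendsto (fun x : Rn n => 4 * B * P * ‖x - x₀‖) (𝓝 x₀) (𝓝 0) := by
    have : Continuous (fun x : Rn n => 4 * B * P * ‖x - x₀‖) := by fun_prop
    simpa using this.tendsto x₀
  have hc3 : Filter.Tendsto (fun x : Rn n => ‖x - x₀‖) (𝓝 x₀) (𝓝 0) := by
    have : Continuous (fun x : Rn n => ‖x - x₀‖) := by fun_prop
    simpa using this.tendsto x₀
  have e1 : (P ^ 2) ^ (γ / 2 - 1) = P ^ (γ - 2) := by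
    rw [← Real.rpow_natCast, ← Real.rpow_mul hP.le]
    congr 1
    push_cast
    ring
  have e2 : (P ^ 2) ^ (γ / 2 - 2) = P ^ (γ - 4) := by
    rw [← Real.rpow_natCast, ← Real.rpow_mul hP.le]
    congr 1
    push_cast
    ring
  have e3 : P ^ (γ - 2) = P ^ (γ - 4) * P ^ 2 := by
    rw [← Real.rpow_natCast P 2, ← Real.rpow_add hP]
    congr 1
    push_cast
    ring
  filter_upwards [hc.eventually (eventually_rpow_le_taylor (γ / 2) (pow_pos hP 2) hε'0),
    hc2.eventually_lt_const (half_pos hε), hc3.eventually_lt_const one_pos] with x h hx1 hx2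
  rw [← norm_rpow_eq_sq_rpow_half, ← norm_rpow_eq_sq_rpow_half, e1, e2] at h
  set w := inner ℝ p (x - x₀) with hw
  have hxp : x - y = p + (x - x₀) := by rw [hp]; abel
  have hD : ‖x - y‖ ^ 2 - P ^ 2 = 2 * w + ‖x - x₀‖ ^ 2 := by
    rw [hxp, norm_add_sq_real]
    ring
  rw [hD] at h
  set r := ‖x - x₀‖ with hr
  have hr0 : 0 ≤ r := norm_nonneg _
  have hwr : |w| ≤ P * r := abs_real_inner_le_norm _ _
  have hwe : inner ℝ (P⁻¹ • p) (x - x₀) = P⁻¹ * w := by rw [real_inner_smul_left]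
  rw [hwe]
  have hD2 := sq_two_mul_add_sq_le hr0 hx2.le hwr
  have hD3 := four_mul_sq_sub_le hwr
  have hq1 : ε' * (2 * w + r ^ 2) ^ 2 ≤ ε / 2 * r ^ 2 := by
    calc ε' * (2 * w + r ^ 2) ^ 2 ≤ ε' * ((2 * P + 1) ^ 2 * r ^ 2) := by gcongr
      _ = ε / 2 * r ^ 2 := by
        rw [hε']
        field_simp
  have hq2 : B * (4 * w ^ 2) - ε / 2 * r ^ 2 ≤ B * (2 * w + r ^ 2) ^ 2 := by
    have := mul_le_mul_of_nonneg_left hD3 hB0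
    have h' := mul_le_mul_of_nonneg_right hx1.le (sq_nonneg r)
    have h'' : B * (4 * w ^ 2 - 4 * P * r ^ 3) = B * (4 * w ^ 2) - 4 * B * P * r * r ^ 2 := by
      ring
    linarith
  have hq3 : 1 / 2 * (γ * P ^ (γ - 2)) * ((2 - γ) * (P⁻¹ * w) ^ 2) = B * (4 * w ^ 2) := by
    rw [e3, hB]
    field_simp
    ring
  have hq4 : γ / 2 * (γ / 2 - 1) / 2 * P ^ (γ - 4) = -B := by
    rw [hB]
    ring
  rw [hq4] at h
  linarith

theorem eventually_radial_le {n : ℕ} {γ : ℝ} (hγ : 0 ≤ γ) (hγ2 : γ ≤ 2) {x₀ y : Rn n}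
    (hxy : x₀ ≠ y) {A k : ℝ} (hA : 0 ≤ A) {ε : ℝ} (hε : 0 < ε) :
    ∀ᶠ x in 𝓝 x₀, A * ‖x - y‖ ^ γ - k / 2 * ‖x - y‖ ^ 2 ≤
      A * ‖x₀ - y‖ ^ γ - k / 2 * ‖x₀ - y‖ ^ 2 +
      inner ℝ ((A * (γ * ‖x₀ - y‖ ^ (γ - 2)) - k) • (x₀ - y)) (x - x₀) +
      1 / 2 * inner ℝ (Matrix.toEuclideanLin (radialHessian (A * (γ * ‖x₀ - y‖ ^ (γ - 2)))
        (2 - γ) k (‖x₀ - y‖⁻¹ • (x₀ - y))) (x - x₀)) (x - x₀) + ε * ‖x - x₀‖ ^ 2 := by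
  have hA1 : 0 < A + 1 := by linarith
  -- The denominator is `A + 1` because `A` may vanish.
  filter_upwards [eventually_norm_rpow_le hγ hγ2 hxy (div_pos hε hA1)] with x h
  rw [inner_radialHessian, real_inner_smul_left]
  have hxp : ‖x - y‖ ^ 2 =
      ‖x₀ - y‖ ^ 2 + 2 * inner ℝ (x₀ - y) (x - x₀) + ‖x - x₀‖ ^ 2 := by
    rw [← norm_add_sq_real]
    congr 2
    abel
  have h1 := mul_le_mul_of_nonneg_left h hA
  have h2 : A * (ε / (A + 1)) ≤ ε := by
    rw [mul_div_assoc', div_le_iff₀ hA1]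
    nlinarith
  have h3 := mul_le_mul_of_nonneg_right h2 (sq_nonneg ‖x - x₀‖)
  rw [hxp]
  linarith

/-! ### Enclosing spheres -/

/-- A segment leaving `Ω` would meet `∂Ω` at some `z`. The enclosing ball at `z` has `Ω`, being
open, in its interior, hence also the segment, although `z` lies on the sphere. -/
theorem UniformExteriorSphere.convex {n : ℕ} {Ω : Set (Rn n)} {R : ℝ} (hR : R ≠ 0)
    (hΩ : IsOpen Ω) (hS : UniformExteriorSphere Ω R) : Convex ℝ Ω := by
  rw [convex_iff_segment_subset]
  intro x hx y hy
  by_contra hsub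
  obtain ⟨p, hp, hpΩ⟩ := Set.not_subset.1 hsub
  have hfr : (segment ℝ x y ∩ frontier Ω).Nonempty := by
    by_contra hne
    have hdisj : segment ℝ x y ∩ frontier Ω = ∅ := Set.not_nonempty_iff_eq_empty.1 hne
    have hpre : IsPreconnected (segment ℝ x y) := (convex_segment x y).isPreconnected
    have hcov : segment ℝ x y ⊆ Ω ∪ (closure Ω)ᶜ := by
      intro z hz
      by_contra hz2
      rw [Set.mem_union, not_or, Set.mem_compl_iff, not_not] at hz2
      have : z ∈ segment ℝ x y ∩ frontier Ω :=
        ⟨hz, by rw [hΩ.frontier_eq]; exact ⟨hz2.2, hz2.1⟩⟩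
      rw [hdisj] at this
      exact this
    obtain ⟨z, -, hz1, hz2⟩ := hpre Ω (closure Ω)ᶜ hΩ isClosed_closure.isOpen_compl hcov
      ⟨x, left_mem_segment ℝ x y, hx⟩ ⟨p, hp, (hcov hp).resolve_left hpΩ⟩
    exact hz2 (subset_closure hz1)
  obtain ⟨z, hz, hzf⟩ := hfr
  obtain ⟨c, hzc, hc⟩ := hS z hzf
  have hball : Ω ⊆ Metric.ball c R := by
    rw [← interior_closedBall c hR]
    exact interior_maximal (subset_closure.trans hc) hΩ
  have := (convex_ball c R).segment_subset (hball hx) (hball hy) hz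
  rw [Metric.mem_ball] at this
  rw [Metric.mem_sphere] at hzc
  linarith

theorem norm_sub_sq_le_of_mem_closedBall {n : ℕ} {c x z : Rn n} {R : ℝ} (hx : ‖x - c‖ = R)
    (hz : ‖z - c‖ ≤ R) : ‖z - x‖ ^ 2 ≤ 2 * inner ℝ (x - c) (x - z) := by
  have h1 : ‖z - c‖ ^ 2 = ‖x - c‖ ^ 2 - 2 * inner ℝ (x - c) (x - z) + ‖x - z‖ ^ 2 := by
    rw [← norm_sub_sq_real]
    congr 2
    abel
  have h2 : ‖z - c‖ ^ 2 ≤ R ^ 2 := by gcongr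
  rw [hx] at h1
  rw [norm_sub_rev z x]
  linarith

/-- Tangent line inequality for a concave power. -/
theorem rpow_le_tangent {σ s t : ℝ} (h0 : 0 ≤ σ) (h1 : σ ≤ 1) (hs : 0 < s) (ht : 0 ≤ t) :
    t ^ σ ≤ s ^ σ + σ * s ^ (σ - 1) * (t - s) := by
  have h := rpow_one_add_le_one_add_mul_self (s := t / s - 1)
    (by linarith [div_nonneg ht hs.le]) h0 h1
  rw [add_sub_cancel, Real.div_rpow ht hs.le, div_le_iff₀ (Real.rpow_pos_of_pos hs σ)] at h
  refine h.trans (le_of_eq ?_)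
  rw [Real.rpow_sub_one hs.ne']
  field_simp

/-- A lower barrier at a boundary point with an enclosing sphere. -/
theorem boundary_lower_bound {n : ℕ} {Ω : Set (Rn n)} {u : Rn n → ℝ} {R σ k N H : ℝ}
    (hΩ : IsOpen Ω) (hb : Bornology.IsBounded Ω) (hu : ContinuousOn u (closure Ω))
    (hσ : 0 < σ) (hσ1 : σ ≤ 1) (hk : 0 ≤ k) (hH : 0 ≤ H)
    (hsuper : ∀ x ∈ Ω, ∀ ξ, ¬ InSubjet Ω u x ξ (radialHessian 0 0 (-k) 0))
    {x c V : Rn n} (hxΩ : x ∉ Ω) (hxc : x ∈ Metric.sphere c R) (hcΩ : closure Ω ⊆ Metric.closedBall c R)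
    (hV : ‖V‖ ≤ N)
    (hbd : ∀ z ∈ frontier Ω, u x + inner ℝ V (z - x) - H * (‖z - x‖ ^ 2) ^ σ ≤ u z)
    {y : Rn n} (hy : y ∈ closure Ω) :
    u x - N * ‖y - x‖ - H * (2 * R * ‖y - x‖) ^ σ - k * R * ‖y - x‖ ≤ u y := by
  rw [mem_sphere_iff_norm] at hxc
  have hR : 0 ≤ R := hxc ▸ norm_nonneg _
  have hball : ∀ z ∈ closure Ω, ‖z - c‖ ≤ R := fun z hz => mem_closedBall_iff_norm.1 (hcΩ hz)
  let t : Rn n → ℝ := fun z => 2 * inner ℝ (x - c) (x - z)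
  have ht : ∀ z ∈ closure Ω, ‖z - x‖ ^ 2 ≤ t z := fun z hz =>
    norm_sub_sq_le_of_mem_closedBall hxc (hball z hz)
  -- `-H t^σ` is convex because `t` is affine and `σ ≤ 1`, so the last term alone gives a Hessian of
  -- at least `k I`. That term is nonpositive on the ball and zero at `x`.
  let ζ : Rn n → ℝ := fun z =>
    u x + inner ℝ V (z - x) - H * t z ^ σ + k / 2 * (‖z - c‖ ^ 2 - R ^ 2)
  have htc : Continuous t := by fun_prop
  have hζc : Continuous ζ := by
    have h := htc.rpow_const (p := σ) fun _ => Or.inr hσ.le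
    fun_prop
  obtain ⟨z₀, hz₀, hmin⟩ := hb.isCompact_closure.exists_isMinOn ⟨y, hy⟩
    (hu.sub hζc.continuousOn)
  have hmin' : ∀ z ∈ closure Ω, u z₀ - ζ z₀ ≤ u z - ζ z := fun z hz => hmin hz
  have hge : 0 ≤ u z₀ - ζ z₀ := by
    by_cases hzΩ : z₀ ∈ Ω
    · exfalso
      have hzx : z₀ ≠ x := fun h => hxΩ (h ▸ hzΩ)
      have ht0 : 0 < t z₀ :=
        (pow_pos (norm_pos_iff.2 (sub_ne_zero.2 hzx)) 2).trans_le (ht z₀ hz₀)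
      -- The vector is the gradient of `ζ` at `z₀`; the tangent line inequality for `t^σ` turns the
      -- minimum of `u - ζ` into a subjet with matrix `k I`.
      refine hsuper z₀ hzΩ
        (V + (H * (σ * t z₀ ^ (σ - 1)) * 2) • (x - c) + k • (z₀ - c)) fun ε hε => ?_
      filter_upwards [self_mem_nhdsWithin] with z hz
      have hzc := subset_closure hz
      have h1 := hmin' z hzc
      have h2 := mul_le_mul_of_nonneg_left (rpow_le_tangent hσ.le hσ1 ht0
        ((sq_nonneg _).trans (ht z hzc))) hH
      have h3 : t z - t z₀ = -2 * inner ℝ (x - c) (z - z₀) := by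
        have : x - z = (x - z₀) - (z - z₀) := by abel
        simp only [t]
        rw [this, inner_sub_right]
        ring
      have h4 : ‖z - c‖ ^ 2 = ‖z₀ - c‖ ^ 2 + 2 * inner ℝ (z₀ - c) (z - z₀) + ‖z - z₀‖ ^ 2 := by
        rw [← norm_add_sq_real]
        congr 2
        abel
      have h5 : inner ℝ V (z - x) = inner ℝ V (z₀ - x) + inner ℝ V (z - z₀) := by
        rw [← inner_add_right]
        congr 1
        abel
      have h6 := mul_nonneg hε.le (sq_nonneg ‖z - z₀‖)
      rw [h3] at h2
      rw [jetPoly, inner_radialHessian, inner_add_left, inner_add_left, real_inner_smul_left,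
        real_inner_smul_left]
      simp only [ζ] at h1
      rw [h4, h5] at h1
      linarith
    · have hzf : z₀ ∈ frontier Ω := by
        rw [hΩ.frontier_eq]
        exact ⟨hz₀, hzΩ⟩
      have h1 := hbd z₀ hzf
      have h2 : (‖z₀ - x‖ ^ 2) ^ σ ≤ t z₀ ^ σ :=
        Real.rpow_le_rpow (sq_nonneg _) (ht z₀ hz₀) hσ.le
      have h3 := mul_le_mul_of_nonneg_left h2 hH
      have h4 : ‖z₀ - c‖ ^ 2 ≤ R ^ 2 := pow_le_pow_left₀ (norm_nonneg _) (hball z₀ hz₀) 2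
      have h5 : k / 2 * (‖z₀ - c‖ ^ 2 - R ^ 2) ≤ 0 :=
        mul_nonpos_of_nonneg_of_nonpos (by linarith) (by linarith)
      simp only [ζ]
      linarith
  have hfin : ζ y ≤ u y := by linarith [hmin' y hy]
  have g1 : -(N * ‖y - x‖) ≤ inner ℝ V (y - x) := by
    have := (abs_le.1 (abs_real_inner_le_norm V (y - x))).1
    have := mul_le_mul_of_nonneg_right hV (norm_nonneg (y - x))
    linarith
  have g2 : t y ≤ 2 * R * ‖y - x‖ := by
    have := real_inner_le_norm (x - c) (x - y)
    rw [hxc, norm_sub_rev x y] at this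
    simp only [t]
    linarith
  have g3 := mul_le_mul_of_nonneg_left
    (Real.rpow_le_rpow ((sq_nonneg _).trans (ht y hy)) g2 hσ.le) hH
  have g4 : R ^ 2 - ‖y - c‖ ^ 2 ≤ 2 * R * ‖y - x‖ := by
    have h1 : ‖y - c‖ ^ 2 = ‖x - c‖ ^ 2 - 2 * inner ℝ (x - c) (x - y) + ‖x - y‖ ^ 2 := by
      rw [← norm_sub_sq_real]
      congr 2
      abel
    rw [hxc] at h1
    simp only [t] at g2
    linarith [sq_nonneg ‖x - y‖]
  have g5 := mul_le_mul_of_nonneg_left g4 (div_nonneg hk zero_le_two)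
  simp only [ζ] at hfin
  linarith

/-- The base `1 + D ≥ 1` allows a constant independent of both exponents. -/
theorem rpow_le_mul_rpow_of_le {r D τ γ : ℝ} (hr : 0 ≤ r) (hrD : r ≤ D) (hγ : 0 ≤ γ)
    (hγτ : γ ≤ τ) (hτ : 0 < τ) (hτ2 : τ ≤ 2) : r ^ τ ≤ (1 + D) ^ 2 * r ^ γ := by
  rcases hr.eq_or_lt with h | h
  · rw [← h, Real.zero_rpow hτ.ne']
    positivity
  · have hD : 1 ≤ 1 + D := by linarith
    calc r ^ τ = r ^ (τ - γ) * r ^ γ := by rw [← Real.rpow_add h, sub_add_cancel]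
      _ ≤ (1 + D) ^ 2 * r ^ γ := by
        refine mul_le_mul_of_nonneg_right ?_ (Real.rpow_nonneg hr _)
        calc r ^ (τ - γ) ≤ (1 + D) ^ (τ - γ) :=
              Real.rpow_le_rpow hr (by linarith) (by linarith)
          _ ≤ (1 + D) ^ (2 : ℝ) := Real.rpow_le_rpow_of_exponent_le hD (by linarith)
          _ = (1 + D) ^ 2 := by norm_cast

/-- Hölder estimate for functions which admit neither certain radial matrices in their superjets
nor `k I` in their subjets. -/
theorem holder_estimate_of_jets {n : ℕ} {Ω : Set (Rn n)} {u : Rn n → ℝ} {R γ σ k N H : ℝ}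
    (hR : 0 < R) (hΩ : IsOpen Ω) (hb : Bornology.IsBounded Ω) (hu : ContinuousOn u (closure Ω))
    (hS : UniformExteriorSphere Ω R) (hγ : 0 ≤ γ) (hγσ : γ ≤ σ)
    (hσ : 0 < σ) (hσ1 : σ ≤ 1) (hk : 0 ≤ k) (hN : 0 ≤ N) (hH : 0 ≤ H)
    (hsub : ∀ x ∈ Ω, ∀ ξ e : Rn n, ∀ c : ℝ, ‖e‖ = 1 → 0 ≤ c →
      ¬ InSuperjet Ω u x ξ (radialHessian c (2 - γ) k e))
    (hsuper : ∀ x ∈ Ω, ∀ ξ, ¬ InSubjet Ω u x ξ (radialHessian 0 0 (-k) 0))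
    (hbd : ∀ x ∈ frontier Ω, ∃ V : Rn n, ‖V‖ ≤ N ∧ ∀ z ∈ frontier Ω,
      u x + inner ℝ V (z - x) - H * (‖z - x‖ ^ 2) ^ σ ≤ u z)
    {x y : Rn n} (hx : x ∈ closure Ω) (hy : y ∈ closure Ω) :
    u x - u y ≤ (1 + 2 * R) ^ 4 * (N + H + k) * ‖x - y‖ ^ γ := by
  revert y
  suffices h : ∀ y ∈ Ω, u x - u y ≤ (1 + 2 * R) ^ 4 * (N + H + k) * ‖x - y‖ ^ γ by
    intro y hy
    refine le_on_closure h (continuousOn_const.sub hu) (Continuous.continuousOn ?_) hy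
    exact continuous_const.mul
      ((by fun_prop : Continuous fun z : Rn n => ‖x - z‖).rpow_const fun _ => Or.inr hγ)
  intro y hy
  set A := (1 + 2 * R) ^ 4 * (N + H + k) with hA
  have hA0 : 0 ≤ A := by positivity
  let w : Rn n → ℝ := fun z => u y + (A * ‖z - y‖ ^ γ - k / 2 * ‖z - y‖ ^ 2)
  have hwc : Continuous w := by
    have h : Continuous fun z : Rn n => ‖z - y‖ ^ γ :=
      (by fun_prop : Continuous fun z : Rn n => ‖z - y‖).rpow_const fun _ => Or.inr hγ
    fun_prop
  obtain ⟨z₀, hz₀, hmax⟩ := hb.isCompact_closure.exists_isMaxOn ⟨x, hx⟩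
    (hu.sub hwc.continuousOn)
  have hmax' : ∀ z ∈ closure Ω, u z - w z ≤ u z₀ - w z₀ := fun z hz => hmax hz
  have hle : u z₀ - w z₀ ≤ 0 := by
    by_cases hzΩ : z₀ ∈ Ω
    · rcases eq_or_ne z₀ y with rfl | hzy
      -- Only the sign is used: for `γ = 0` the power is `0 ^ 0 = 1`.
      · have : 0 ≤ A * ‖z₀ - z₀‖ ^ γ := by positivity
        simp only [w]
        simp at this ⊢
        exact this
      · exfalso
        have hp : 0 < ‖z₀ - y‖ := norm_pos_iff.2 (sub_ne_zero.2 hzy)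
        refine hsub z₀ hzΩ ((A * (γ * ‖z₀ - y‖ ^ (γ - 2)) - k) • (z₀ - y)) (‖z₀ - y‖⁻¹ • (z₀ - y)) (A * (γ * ‖z₀ - y‖ ^ (γ - 2)))
          (by rw [norm_smul, norm_inv, norm_norm, inv_mul_cancel₀ hp.ne']) (by positivity)
          fun ε hε => ?_
        filter_upwards [self_mem_nhdsWithin, nhdsWithin_le_nhds
          (eventually_radial_le hγ (by linarith) hzy (k := k) hA0 hε)] with z hz h
        have h1 := hmax' z (subset_closure hz)
        rw [jetPoly]
        simp only [w] at h1
        linarith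
    · have hzf : z₀ ∈ frontier Ω := by
        rw [hΩ.frontier_eq]
        exact ⟨hz₀, hzΩ⟩
      obtain ⟨c, hzc, hcΩ⟩ := hS z₀ hzf
      obtain ⟨V, hV, hVz⟩ := hbd z₀ hzf
      -- The barrier based at `z₀` is evaluated at `y`, which bounds `u z₀ - u y` from above.
      have h1 := boundary_lower_bound hΩ hb hu hσ hσ1 hk hH hsuper hzΩ hzc hcΩ hV hVz
        (subset_closure hy)
      rw [norm_sub_rev y z₀] at h1
      set r := ‖z₀ - y‖ with hr
      have hr0 : 0 ≤ r := norm_nonneg _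
      have hrR : r ≤ 2 * R := by
        have := dist_triangle_right z₀ y c
        have h2 := Metric.mem_closedBall.1 (hcΩ (subset_closure hy))
        rw [Metric.mem_sphere] at hzc
        rw [dist_eq_norm] at this
        linarith
      have hR1 : 1 ≤ 1 + 2 * R := by linarith
      set M := (1 + 2 * R) with hM
      have k1 : r ≤ M ^ 2 * r ^ γ := by
        simpa using rpow_le_mul_rpow_of_le hr0 hrR hγ (hγσ.trans hσ1) one_pos one_le_two
      have k2 : r ^ 2 ≤ M ^ 2 * r ^ γ := by
        have := rpow_le_mul_rpow_of_le hr0 hrR hγ (by linarith) two_pos le_rfl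
        norm_cast at this
      have k3 : r ^ σ ≤ M ^ 2 * r ^ γ :=
        rpow_le_mul_rpow_of_le hr0 hrR hγ hγσ hσ (by linarith)
      have k4 : (2 * R * r) ^ σ ≤ M * (M ^ 2 * r ^ γ) := by
        rw [Real.mul_rpow (by positivity) hr0]
        refine mul_le_mul ?_ k3 (by positivity) (by positivity)
        calc (2 * R) ^ σ ≤ M ^ σ := Real.rpow_le_rpow (by positivity) (by linarith) hσ.le
          _ ≤ M ^ (1 : ℝ) := Real.rpow_le_rpow_of_exponent_le hR1 hσ1
          _ = M := Real.rpow_one M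
      have hq : 0 ≤ r ^ γ := by positivity
      set q := r ^ γ
      have j1 : N * r ≤ M ^ 4 * N * q := by
        calc N * r ≤ N * (M ^ 2 * q) := by gcongr
          _ ≤ N * (M ^ 4 * q) := by gcongr; norm_num
          _ = M ^ 4 * N * q := by ring
      have j2 : H * (2 * R * r) ^ σ ≤ M ^ 4 * H * q := by
        calc H * (2 * R * r) ^ σ ≤ H * (M * (M ^ 2 * q)) := by gcongr
          _ = H * (M ^ 3 * q) := by ring
          _ ≤ H * (M ^ 4 * q) := by gcongr; norm_num
          _ = M ^ 4 * H * q := by ring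
      -- The first term is the loss in the barrier, the second compensates the quadratic term of
      -- `w`; together they give the factor `R + 1/2 = M/2`.
      have j3 : k * R * r + k / 2 * r ^ 2 ≤ M ^ 4 * k * q := by
        calc k * R * r + k / 2 * r ^ 2 ≤ k * R * (M ^ 2 * q) + k / 2 * (M ^ 2 * q) := by gcongr
          _ = M / 2 * (k * (M ^ 2 * q)) := by rw [hM]; ring
          _ ≤ M ^ 2 * (k * (M ^ 2 * q)) := by
            gcongr
            nlinarith
          _ = M ^ 4 * k * q := by ring
      have j4 : A * q = M ^ 4 * N * q + M ^ 4 * H * q + M ^ 4 * k * q := by rw [hA]; ring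
      simp only [w]
      rw [j4]
      linarith
  have hfin := hmax' x hx
  simp only [w] at hfin hle
  have := mul_nonneg (div_nonneg hk zero_le_two) (sq_nonneg ‖x - y‖)
  linarith

/-! ### Jets of solutions -/

theorem InSuperjet.neg {n : ℕ} {O : Set (Rn n)} {u : Rn n → ℝ} {x ξ : Rn n}
    {X : Matrix (Fin n) (Fin n) ℝ} (h : InSuperjet O (fun z => -u z) x ξ X) :
    InSubjet O u x (-ξ) (-X) := by
  intro ε hε
  filter_upwards [h ε hε] with z hz
  simp only [jetPoly, map_neg, LinearMap.neg_apply, inner_neg_left] at hz ⊢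
  linarith

theorem InSubjet.neg {n : ℕ} {O : Set (Rn n)} {u : Rn n → ℝ} {x ξ : Rn n}
    {X : Matrix (Fin n) (Fin n) ℝ} (h : InSubjet O (fun z => -u z) x ξ X) :
    InSuperjet O u x (-ξ) (-X) := by
  intro ε hε
  filter_upwards [h ε hε] with z hz
  simp only [jetPoly, map_neg, LinearMap.neg_apply, inner_neg_left] at hz ⊢
  linarith

section Solutions

variable {m : ℕ} {a : Fin (m + 1) → ℝ} {Ω : Set (Rn (m + 1))} {f g u : Rn (m + 1) → ℝ}

/-- The form is `c(γ - 1) - k` along `e` and at most `c - k` in every unit direction. The sign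
condition on `γ` removes `c`, however large. -/
theorem weightedTrace_radialHessian_le (ha : ∀ i, 0 ≤ a i) {γ k c : ℝ} (hγ2 : γ ≤ 2)
    (haγ : a 0 * (γ - 1) + weightHat a 0 ≤ 0) {e : Rn (m + 1)} (he : ‖e‖ = 1) (hc : 0 ≤ c)
    (hX : (radialHessian c (2 - γ) k e).IsHermitian) :
    weightedTrace a hX ≤ -k * ∑ i, a i := by
  have h := weightedTrace_le ha hX (M := c - k) (q := c * (γ - 1) - k) (fun v => ?_) he ?_
  · have := mul_nonpos_of_nonneg_of_nonpos hc haγ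
    rw [weightHat] at this h
    linarith
  · rw [inner_radialHessian]
    have := mul_nonneg (mul_nonneg hc (sub_nonneg.2 hγ2)) (sq_nonneg (inner ℝ e v))
    linarith
  · rw [inner_radialHessian, real_inner_self_eq_norm_sq, he]
    linarith

theorem le_weightedTrace_neg_radialHessian (ha : ∀ i, 0 ≤ a i) {γ k c : ℝ} (hγ2 : γ ≤ 2)
    (haγ : a (Fin.last m) * (γ - 1) + weightHat a (Fin.last m) ≤ 0) {e : Rn (m + 1)}
    (he : ‖e‖ = 1) (hc : 0 ≤ c) (hX : (-radialHessian c (2 - γ) k e).IsHermitian) :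
    k * ∑ i, a i ≤ weightedTrace a hX := by
  have h := le_weightedTrace ha hX (M := k - c) (q := k - c * (γ - 1)) (fun v => ?_) he ?_
  · have := mul_nonpos_of_nonneg_of_nonpos hc haγ
    rw [weightHat] at this h
    linarith
  · rw [map_neg, LinearMap.neg_apply, inner_neg_left, inner_radialHessian]
    have := mul_nonneg (mul_nonneg hc (sub_nonneg.2 hγ2)) (sq_nonneg (inner ℝ e v))
    linarith
  · rw [map_neg, LinearMap.neg_apply, inner_neg_left, inner_radialHessian,
      real_inner_self_eq_norm_sq, he]
    linarith

theorem exists_norm_eq_one (m : ℕ) : ∃ e : Rn (m + 1), ‖e‖ = 1 :=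
  ⟨EuclideanSpace.single 0 1, by simp⟩

theorem le_weightedTrace_scalar (ha : ∀ i, 0 ≤ a i) {k : ℝ}
    (hX : (radialHessian 0 0 (-k) (0 : Rn (m + 1))).IsHermitian) :
    k * ∑ i, a i ≤ weightedTrace a hX := by
  obtain ⟨e, he⟩ := exists_norm_eq_one m
  have h := le_weightedTrace ha hX (M := k) (q := k) (fun v => ?_) he ?_
  · rw [weightHat] at h
    linarith
  · rw [inner_radialHessian]
    linarith
  · rw [inner_radialHessian, he]
    linarith

theorem weightedTrace_neg_scalar_le (ha : ∀ i, 0 ≤ a i) {k : ℝ}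
    (hX : (-radialHessian 0 0 (-k) (0 : Rn (m + 1))).IsHermitian) :
    weightedTrace a hX ≤ -k * ∑ i, a i := by
  obtain ⟨e, he⟩ := exists_norm_eq_one m
  have h := weightedTrace_le ha hX (M := -k) (q := -k) (fun v => ?_) he ?_
  · rw [weightHat] at h
    linarith
  · rw [map_neg, LinearMap.neg_apply, inner_neg_left, inner_radialHessian]
    linarith
  · rw [map_neg, LinearMap.neg_apply, inner_neg_left, inner_radialHessian, he]
    linarith

theorem IsWeight.sum_pos (ha : IsWeight a) : 0 < ∑ i, a i := by
  obtain ⟨j, hj⟩ := ha.2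
  exact Finset.sum_pos' (fun i _ => ha.1 i) ⟨j, Finset.mem_univ j, hj⟩

theorem mul_sub_one_add_le {p q γ : ℝ} (hp : 0 < p) (h : γ ≤ 1 - q / p) :
    p * (γ - 1) + q ≤ 0 := by
  have := mul_le_mul_of_nonneg_left h hp.le
  rw [mul_sub, mul_div_cancel₀ _ hp.ne'] at this
  linarith

theorem asymmetryExponent_cases (ha : IsWeight a) (has : IsAsymmetric a) {γ : ℝ}
    (hγ : γ ≤ asymmetryExponent a) :
    a 0 * (γ - 1) + weightHat a 0 ≤ 0 ∨
      a (Fin.last m) * (γ - 1) + weightHat a (Fin.last m) ≤ 0 := by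
  have hs := ha.sum_pos
  rw [asymmetryExponent] at hγ
  rw [IsAsymmetric, weightHat, weightHat] at has
  split_ifs at hγ with h0 hl
  · refine Or.inr (mul_sub_one_add_le ?_ hγ)
    rcases has with h | h <;> linarith
  · exact Or.inl (mul_sub_one_add_le ((ha.1 0).lt_of_ne' h0) hγ)
  · rcases le_max_iff.1 hγ with h | h
    · exact Or.inl (mul_sub_one_add_le ((ha.1 0).lt_of_ne' h0) h)
    · exact Or.inr (mul_sub_one_add_le ((ha.1 _).lt_of_ne' hl) h)

theorem asymmetryExponent_nonneg (ha : IsWeight a) (has : IsAsymmetric a) :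
    0 ≤ asymmetryExponent a := by
  have hs := ha.sum_pos
  rw [asymmetryExponent]
  have key : ∀ j, weightHat a j ≤ a j → 0 ≤ 1 - weightHat a j / a j := fun j hj => by
    rw [sub_nonneg]
    exact div_le_one_of_le₀ hj (ha.1 j)
  have h0' : ∀ j, a j = 0 → ¬ weightHat a j ≤ a j := fun j hj h => by
    rw [weightHat] at h
    linarith
  split_ifs with h0 hl
  · exact key _ (has.resolve_left (h0' _ h0))
  · exact key _ (has.resolve_right (h0' _ hl))
  · rcases has with h | h
    · exact le_max_of_le_left (key _ h)
    · exact le_max_of_le_right (key _ h)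

/-- The strict bound on `f` contradicts the viscosity inequalities at the forbidden jets. If only
the last weight gives the sign condition, the argument runs for `-u` with slopes `-V`. -/
theorem IsDirichletSolution.abs_sub_le_of_strict (ha : IsWeight a) (has : IsAsymmetric a)
    (hu : IsDirichletSolution a Ω f g u) {R γ σ k N H : ℝ} (hR : 0 < R)
    (hS : UniformExteriorSphere Ω R) (hγ : 0 ≤ γ) (hγa : γ ≤ asymmetryExponent a) (hγσ : γ ≤ σ)
    (hσ : 0 < σ) (hσ1 : σ ≤ 1) (hk : 0 ≤ k) (hN : 0 ≤ N) (hH : 0 ≤ H)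
    (hf : ∀ x ∈ Ω, |f x| < k * ∑ i, a i)
    (hbd : ∀ x ∈ frontier Ω, ∃ V : Rn (m + 1), ‖V‖ ≤ N ∧ ∀ z ∈ frontier Ω,
      |g z - g x - inner ℝ V (z - x)| ≤ H * (‖z - x‖ ^ 2) ^ σ)
    {x y : Rn (m + 1)} (hx : x ∈ closure Ω) (hy : y ∈ closure Ω) :
    |u x - u y| ≤ (1 + 2 * R) ^ 4 * (N + H + k) * ‖x - y‖ ^ γ := by
  have hγ2 : γ ≤ 2 := by linarith
  have hrad := fun c e => radialHessian_isHermitian (n := m + 1) c (2 - γ) k e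
  have hsc := radialHessian_isHermitian (n := m + 1) 0 0 (-k) 0
  rw [abs_le']
  rcases asymmetryExponent_cases ha has hγa with h | h
  · have key : ∀ x ∈ closure Ω, ∀ y ∈ closure Ω,
        u x - u y ≤ (1 + 2 * R) ^ 4 * (N + H + k) * ‖x - y‖ ^ γ := fun x hx y hy => by
      refine holder_estimate_of_jets hR hu.isOpen hu.isBounded hu.continuousOn hS hγ hγσ hσ hσ1
        hk hN hH (fun z hz ξ e c he hc hj => ?_) (fun z hz ξ hj => ?_) (fun z hz => ?_) hx hy
      · have h1 := hu.subsolution.2 z hz ξ _ (hrad c e) hj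
        have h2 := weightedTrace_radialHessian_le ha.1 hγ2 h he hc (hrad c e)
        have h3 := (abs_lt.1 (hf z hz)).1
        linarith
      · have h1 := hu.supersolution.2 z hz ξ _ hsc hj
        have h2 := le_weightedTrace_scalar ha.1 hsc
        have h3 := (abs_lt.1 (hf z hz)).2
        linarith
      · obtain ⟨V, hV, hVz⟩ := hbd z hz
        refine ⟨V, hV, fun w hw => ?_⟩
        rw [hu.boundary z hz, hu.boundary w hw]
        linarith [(abs_le.1 (hVz w hw)).1]
    refine ⟨key x hx y hy, ?_⟩
    rw [neg_sub, norm_sub_rev]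
    exact key y hy x hx
  · have key : ∀ x ∈ closure Ω, ∀ y ∈ closure Ω,
        -u x - -u y ≤ (1 + 2 * R) ^ 4 * (N + H + k) * ‖x - y‖ ^ γ := fun x hx y hy => by
      refine holder_estimate_of_jets (u := fun z => -u z) hR hu.isOpen hu.isBounded
        hu.continuousOn.neg hS hγ hγσ hσ hσ1
        hk hN hH (fun z hz ξ e c he hc hj => ?_) (fun z hz ξ hj => ?_) (fun z hz => ?_) hx hy
      · have h1 := hu.supersolution.2 z hz (-ξ) _ (hrad c e).neg hj.neg
        have h2 := le_weightedTrace_neg_radialHessian ha.1 hγ2 h he hc (hrad c e).neg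
        have h3 := (abs_lt.1 (hf z hz)).2
        linarith
      · have h1 := hu.subsolution.2 z hz (-ξ) _ hsc.neg hj.neg
        have h2 := weightedTrace_neg_scalar_le ha.1 hsc.neg
        have h3 := (abs_lt.1 (hf z hz)).1
        linarith
      · obtain ⟨V, hV, hVz⟩ := hbd z hz
        refine ⟨-V, by rwa [norm_neg], fun w hw => ?_⟩
        rw [hu.boundary z hz, hu.boundary w hw, inner_neg_left]
        linarith [(abs_le.1 (hVz w hw)).2]
    refine ⟨?_, ?_⟩
    · have := key y hy x hx
      rw [norm_sub_rev] at this
      linarith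
    · linarith [key x hx y hy]

/-- The constant of the Hölder estimates. -/
def holderConstant (m : ℕ) (aMean R : ℝ) : ℝ :=
  (1 + 2 * R) ^ 4 * (1 + |((m : ℝ) + 1) * aMean|⁻¹)

/-- The absolute value in the constant gives positivity even for a number that is not the mean of a
weight, as the constant is chosen before the weight. -/
theorem holderConstant_pos {aMean R : ℝ} (hR : 0 < R) : 0 < holderConstant m aMean R := by
  rw [holderConstant]
  positivity

theorem IsDirichletSolution.abs_sub_le (ha : IsWeight a) (has : IsAsymmetric a)
    (hu : IsDirichletSolution a Ω f g u) {R γ σ F N H : ℝ} (hR : 0 < R)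
    (hS : UniformExteriorSphere Ω R) (hγ : 0 ≤ γ) (hγa : γ ≤ asymmetryExponent a) (hγσ : γ ≤ σ)
    (hσ : 0 < σ) (hσ1 : σ ≤ 1) (hF : 0 ≤ F) (hN : 0 ≤ N) (hH : 0 ≤ H)
    (hf : ∀ x ∈ Ω, |f x| ≤ F)
    (hbd : ∀ x ∈ frontier Ω, ∃ V : Rn (m + 1), ‖V‖ ≤ N ∧ ∀ z ∈ frontier Ω,
      |g z - g x - inner ℝ V (z - x)| ≤ H * (‖z - x‖ ^ 2) ^ σ)
    {x y : Rn (m + 1)} (hx : x ∈ closure Ω) (hy : y ∈ closure Ω) :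
    |u x - u y| ≤ holderConstant m (weightMean a) R * (N + H + F) * ‖x - y‖ ^ γ := by
  have hs := ha.sum_pos
  have hm : ((m : ℝ) + 1) * weightMean a = ∑ i, a i := by
    rw [weightMean]
    field_simp
  rw [holderConstant, hm, abs_of_pos hs]
  set s := ∑ i, a i
  refine le_of_forall_pos_le_add fun δ hδ => ?_
  set q := (1 + 2 * R) ^ 4 * ‖x - y‖ ^ γ with hq
  have hq0 : 0 ≤ q := by positivity
  set ε := δ / (q + 1) with hε
  have hε0 : 0 < ε := by positivity
  -- `k = F/|a| + ε` makes the bound on `f` strict; `ε` costs at most `δ`.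
  have h := hu.abs_sub_le_of_strict ha has hR hS hγ hγa hγσ hσ hσ1
    (k := F / s + ε) (by positivity) hN hH (fun z hz => ?_) hbd hx hy
  · have h1 : q * ε ≤ δ := by
      rw [hε, mul_div_assoc', div_le_iff₀ (by positivity)]
      nlinarith
    have h2 : 0 ≤ q * (s⁻¹ * (N + H) + F) := by positivity
    calc |u x - u y| ≤ (1 + 2 * R) ^ 4 * (N + H + (F / s + ε)) * ‖x - y‖ ^ γ := h
      _ = q * (N + H + F * s⁻¹) + q * ε := by rw [hq, div_eq_mul_inv]; ring
      _ ≤ q * (N + H + F * s⁻¹) + q * (s⁻¹ * (N + H) + F) + δ := by linarith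
      _ = _ := by rw [hq]; ring
  · rw [add_mul, div_mul_cancel₀ _ hs.ne']
    have := mul_pos hε0 hs
    linarith [hf z hz]

end Solutions

/-! ### Hölder norms -/

/-- By continuity a violation would persist on a nonempty open set, which has positive measure. -/
theorem enorm_le_linftyNorm {n : ℕ} {Ω : Set (Rn n)} {f : Rn n → ℝ} (hΩ : IsOpen Ω)
    (hf : ContinuousOn f Ω) {x : Rn n} (hx : x ∈ Ω) : ‖f x‖ₑ ≤ linftyNorm Ω f := by
  by_contra! h
  set U := Ω ∩ (fun z => ‖f z‖ₑ) ⁻¹' Ioi (linftyNorm Ω f) with hU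
  have hUo : IsOpen U := (continuous_enorm.comp_continuousOn hf).isOpen_inter_preimage hΩ isOpen_Ioi
  have hpos : 0 < volume U := hUo.measure_pos volume ⟨x, hx, h⟩
  have hae : ∀ᵐ z ∂(volume.restrict Ω), ‖f z‖ₑ ≤ linftyNorm Ω f := by
    rw [linftyNorm, eLpNorm_exponent_top]
    exact ae_le_eLpNormEssSup
  rw [ae_restrict_iff' hΩ.measurableSet, ae_iff] at hae
  refine hpos.ne' (measure_mono_null (fun z hz => ?_) hae)
  simp only [mem_ofPred_eq, not_forall, not_le]
  exact ⟨hz.1, hz.2⟩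

theorem linftyNorm_lt_top {n : ℕ} {Ω : Set (Rn n)} {f : Rn n → ℝ} (hΩ : IsOpen Ω)
    (hf : ∃ M : ℝ, ∀ x ∈ Ω, |f x| ≤ M) : linftyNorm Ω f < ∞ := by
  obtain ⟨M, hM⟩ := hf
  rw [linftyNorm, eLpNorm_exponent_top]
  refine eLpNormEssSup_lt_top_of_ae_bound (C := M) ?_
  exact (ae_restrict_iff' hΩ.measurableSet).2 (Filter.Eventually.of_forall hM)

theorem norm_sub_le_of_holderSeminorm {n : ℕ} {F : Type} [NormedAddCommGroup F] {β : ℝ}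
    (hβ : 0 ≤ β) {D : Set (Rn n)} {h : Rn n → F} (hh : holderSeminorm β D h ≠ ∞) {x y : Rn n}
    (hx : x ∈ D) (hy : y ∈ D) :
    ‖h x - h y‖ ≤ (holderSeminorm β D h).toReal * ‖x - y‖ ^ β := by
  have hm := eHolderNorm_ne_top.1 hh
  have := hm.holderWith.dist_le (⟨x, hx⟩ : D) ⟨y, hy⟩
  rwa [dist_eq_norm, Subtype.dist_eq, dist_eq_norm, Real.coe_toNNReal β hβ] at this

theorem holderSeminorm_le {n : ℕ} {F : Type} [NormedAddCommGroup F] {γ A : ℝ}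
    (hγ : 0 ≤ γ) (hA : 0 ≤ A) {D : Set (Rn n)} {h : Rn n → F}
    (hh : ∀ x ∈ D, ∀ y ∈ D, ‖h x - h y‖ ≤ A * ‖x - y‖ ^ γ) :
    holderSeminorm γ D h ≤ ENNReal.ofReal A := by
  refine HolderWith.eHolderNorm_le (C := A.toNNReal) fun x y => ?_
  have h1 := hh x x.2 y y.2
  rw [edist_dist, edist_dist, Subtype.dist_eq, dist_eq_norm, dist_eq_norm,
    Real.coe_toNNReal γ hγ, ENNReal.ofReal_rpow_of_nonneg (norm_nonneg _) hγ,
    ← ENNReal.ofReal, ← ENNReal.ofReal_mul hA]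
  exact ENNReal.ofReal_le_ofReal h1

theorem norm_le_supNormOn {n : ℕ} {F : Type} [NormedAddCommGroup F] {D : Set (Rn n)}
    {h : Rn n → F} (hh : supNormOn D h ≠ ∞) {x : Rn n} (hx : x ∈ D) :
    ‖h x‖ ≤ (supNormOn D h).toReal := by
  rw [← toReal_enorm]
  exact ENNReal.toReal_mono hh (le_iSup₂ (f := fun x (_ : x ∈ D) => ‖h x‖ₑ) x hx)

theorem supNormOn_lt_top {n : ℕ} {D : Set (Rn n)} (hD : IsCompact D) {h : Rn n → ℝ}
    (hh : ContinuousOn h D) : supNormOn D h < ∞ := by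
  obtain ⟨M, hM⟩ := hD.exists_bound_of_continuousOn hh
  refine lt_of_le_of_lt (iSup₂_le fun x hx => ?_) (ENNReal.ofReal_lt_top (r := M))
  rw [← ofReal_norm]
  exact ENNReal.ofReal_le_ofReal (hM x hx)

/-! ### Taylor expansion on convex sets -/

/-- Mean value inequality along segments inside the convex `Ω`, where `V` is the gradient;
continuity then reaches boundary points. -/
theorem abs_sub_sub_inner_le {n : ℕ} {Ω : Set (Rn n)} {g G : Rn n → ℝ} {V : Rn n → Rn n}
    (hΩ : Convex ℝ Ω) (hG : IsC1Extension Ω g G V) {β H : ℝ} (hβ : 0 ≤ β) (hH : 0 ≤ H)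
    (hV : ∀ x ∈ closure Ω, ∀ y ∈ closure Ω, ‖V x - V y‖ ≤ H * ‖x - y‖ ^ β)
    {x z : Rn n} (hx : x ∈ closure Ω) (hz : z ∈ closure Ω) :
    |G z - G x - inner ℝ (V x) (z - x)| ≤ H * (‖z - x‖ ^ 2) ^ ((1 + β) / 2) := by
  have key : ∀ p ∈ Ω ×ˢ Ω, |G p.2 - G p.1 - inner ℝ (V p.1) (p.2 - p.1)| ≤
      H * (‖p.2 - p.1‖ ^ 2) ^ ((1 + β) / 2) := by
    rintro ⟨x, z⟩ ⟨hx, hz⟩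
    simp only at hx hz ⊢
    have hseg := hΩ.segment_subset hx hz
    have h := (convex_segment x z).norm_image_sub_le_of_norm_hasFDerivWithin_le'
      (f := G) (f' := fun w => InnerProductSpace.toDual ℝ (Rn n) (V w))
      (φ := InnerProductSpace.toDual ℝ (Rn n) (V x)) (C := H * ‖z - x‖ ^ β)
      (fun w hw => (hG.hasGradientAt w (hseg hw)).hasFDerivAt.hasFDerivWithinAt)
      (fun w hw => ?_) (left_mem_segment ℝ x z) (right_mem_segment ℝ x z)
    · rw [InnerProductSpace.toDual_apply_apply, Real.norm_eq_abs] at h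
      refine h.trans (le_of_eq ?_)
      rcases eq_or_ne z x with rfl | hzx
      · have : (1 + β) / 2 ≠ 0 := by positivity
        simp [Real.zero_rpow this]
      · rw [← norm_rpow_eq_sq_rpow_half,
          Real.rpow_add (norm_pos_iff.2 (sub_ne_zero.2 hzx)), Real.rpow_one]
        ring
    · rw [← map_sub, LinearIsometryEquiv.norm_map]
      refine (hV w (subset_closure (hseg hw)) x (subset_closure hx)).trans ?_
      gcongr
      exact norm_sub_le_of_mem_segment hw
  have h1 : ContinuousOn (fun p : Rn n × Rn n =>
      |G p.2 - G p.1 - inner ℝ (V p.1) (p.2 - p.1)|) (closure (Ω ×ˢ Ω)) := by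
    rw [closure_prod_eq]
    have hfst : MapsTo Prod.fst (closure Ω ×ˢ closure Ω) (closure Ω) := fun p hp => hp.1
    have hsnd : MapsTo Prod.snd (closure Ω ×ˢ closure Ω) (closure Ω) := fun p hp => hp.2
    exact (((hG.continuousOn.comp continuousOn_snd hsnd).sub
      (hG.continuousOn.comp continuousOn_fst hfst)).sub
      ((hG.continuousOn_grad.comp continuousOn_fst hfst).inner
        (continuousOn_snd.sub continuousOn_fst))).abs
  have h2 : Continuous (fun p : Rn n × Rn n => H * (‖p.2 - p.1‖ ^ 2) ^ ((1 + β) / 2)) :=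
    continuous_const.mul ((by fun_prop : Continuous fun p : Rn n × Rn n =>
      ‖p.2 - p.1‖ ^ 2).rpow_const fun _ => Or.inr (by positivity))
  exact le_on_closure (x := (x, z)) key h1 h2.continuousOn
    (by rw [closure_prod_eq]; exact ⟨hx, hz⟩)

/-! ### Estimates in terms of the boundary norms -/

section Estimates

variable {m : ℕ} {a : Fin (m + 1) → ℝ} {Ω : Set (Rn (m + 1))} {f g u : Rn (m + 1) → ℝ}

theorem IsDirichletSolution.holder_of_expansion (ha : IsWeight a) (has : IsAsymmetric a)
    (hu : IsDirichletSolution a Ω f g u) {R γ σ N H : ℝ} (hR : 0 < R)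
    (hS : UniformExteriorSphere Ω R) (hγ : 0 ≤ γ) (hγa : γ ≤ asymmetryExponent a) (hγσ : γ ≤ σ)
    (hσ : 0 < σ) (hσ1 : σ ≤ 1) (hN : 0 ≤ N) (hH : 0 ≤ H)
    (hbd : ∀ x ∈ frontier Ω, ∃ V : Rn (m + 1), ‖V‖ ≤ N ∧ ∀ z ∈ frontier Ω,
      |g z - g x - inner ℝ V (z - x)| ≤ H * (‖z - x‖ ^ 2) ^ σ) :
    HolderOn γ (closure Ω) u ∧ holderSeminorm γ Ω u ≤
      (holderConstant m (weightMean a) R).toNNReal *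
        (ENNReal.ofReal N + ENNReal.ofReal H + linftyNorm Ω f) := by
  have hC := (holderConstant_pos (m := m) (aMean := weightMean a) hR).le
  have hft := linftyNorm_lt_top hu.isOpen hu.bounded_rhs
  have hF : 0 ≤ (linftyNorm Ω f).toReal := ENNReal.toReal_nonneg
  have hf : ∀ x ∈ Ω, |f x| ≤ (linftyNorm Ω f).toReal := fun x hx => by
    rw [← Real.norm_eq_abs, ← toReal_enorm]
    exact ENNReal.toReal_mono hft.ne (enorm_le_linftyNorm hu.isOpen hu.continuousOn_rhs hx)
  have key : ∀ x ∈ closure Ω, ∀ y ∈ closure Ω, ‖u x - u y‖ ≤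
      holderConstant m (weightMean a) R * (N + H + (linftyNorm Ω f).toReal) * ‖x - y‖ ^ γ :=
    fun x hx y hy =>
      hu.abs_sub_le ha has hR hS hγ hγa hγσ hσ hσ1 hF hN hH hf hbd hx hy
  refine ⟨⟨hu.continuousOn, ENNReal.add_lt_top.2
    ⟨supNormOn_lt_top hu.isBounded.isCompact_closure hu.continuousOn,
      (holderSeminorm_le hγ (by positivity) key).trans_lt ENNReal.ofReal_lt_top⟩⟩, ?_⟩
  refine (holderSeminorm_le hγ (by positivity)
    fun x hx y hy => key x (subset_closure hx) y (subset_closure hy)).trans (le_of_eq ?_)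
  rw [ENNReal.ofReal_mul hC, ENNReal.ofReal_add (by positivity) hF, ENNReal.ofReal_add hN hH,
    ENNReal.ofReal_toReal hft.ne]
  rfl

theorem IsDirichletSolution.holder_of_holderOn (ha : IsWeight a) (has : IsAsymmetric a)
    (hu : IsDirichletSolution a Ω f g u) {R γ β : ℝ} (hR : 0 < R)
    (hS : UniformExteriorSphere Ω R) (hγ : 0 ≤ γ) (hγa : γ ≤ asymmetryExponent a)
    (hγβ : γ ≤ β / 2) (hβ : 0 < β) (hβ1 : β ≤ 1) (hg : HolderOn β (frontier Ω) g) :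
    HolderOn γ (closure Ω) u ∧ holderSeminorm γ Ω u ≤
      (holderConstant m (weightMean a) R).toNNReal *
        (holderNorm β (frontier Ω) g + linftyNorm Ω f) := by
  have hgt : holderSeminorm β (frontier Ω) g ≠ ∞ := (ENNReal.add_lt_top.1 hg.2).2.ne
  have h := hu.holder_of_expansion ha has hR hS hγ hγa hγβ (half_pos hβ) (by linarith) le_rfl
    (ENNReal.toReal_nonneg (a := holderSeminorm β (frontier Ω) g)) fun x hx =>
      ⟨0, norm_zero.le, fun z hz => by
        rw [inner_zero_left, sub_zero, ← norm_rpow_eq_sq_rpow_half]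
        exact norm_sub_le_of_holderSeminorm hβ.le hgt hz hx⟩
  refine ⟨h.1, h.2.trans ?_⟩
  rw [ENNReal.ofReal_zero, zero_add, ENNReal.ofReal_toReal hgt]
  gcongr
  exact le_add_self

theorem IsDirichletSolution.holder_of_isC1Extension (ha : IsWeight a) (has : IsAsymmetric a)
    (hu : IsDirichletSolution a Ω f g u) {R γ β : ℝ} (hR : 0 < R)
    (hS : UniformExteriorSphere Ω R) (hγ : 0 ≤ γ) (hγa : γ ≤ asymmetryExponent a)
    (hγβ : γ ≤ (1 + β) / 2) (hβ : 0 ≤ β) (hβ1 : β ≤ 1) {G : Rn (m + 1) → ℝ}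
    {V : Rn (m + 1) → Rn (m + 1)} (hG : IsC1Extension Ω g G V)
    (hfin : supNormOn (closure Ω) G + supNormOn (closure Ω) V +
      holderSeminorm β (closure Ω) V < ∞) :
    HolderOn γ (closure Ω) u ∧ holderSeminorm γ Ω u ≤
      (holderConstant m (weightMean a) R).toNNReal *
        (supNormOn (closure Ω) G + supNormOn (closure Ω) V +
          holderSeminorm β (closure Ω) V + linftyNorm Ω f) := by
  obtain ⟨h1, hH⟩ := ENNReal.add_lt_top.1 hfin
  have hV := (ENNReal.add_lt_top.1 h1).2
  have hfr : frontier Ω ⊆ closure Ω := frontier_subset_closure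
  have h := hu.holder_of_expansion ha has hR hS hγ hγa hγβ (by positivity) (by linarith)
    (ENNReal.toReal_nonneg (a := supNormOn (closure Ω) V))
    (ENNReal.toReal_nonneg (a := holderSeminorm β (closure Ω) V)) fun x hx =>
      ⟨V x, norm_le_supNormOn hV.ne (hfr hx), fun z hz => by
        rw [← hG.eq_boundary z hz, ← hG.eq_boundary x hx]
        exact abs_sub_sub_inner_le (hS.convex hR.ne' hu.isOpen) hG hβ ENNReal.toReal_nonneg
          (fun x hx y hy => norm_sub_le_of_holderSeminorm hβ hH.ne hx hy) (hfr hx) (hfr hz)⟩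
  refine ⟨h.1, h.2.trans ?_⟩
  rw [ENNReal.ofReal_toReal hV.ne, ENNReal.ofReal_toReal hH.ne]
  gcongr
  exact le_add_self

theorem IsDirichletSolution.holder_of_boundaryC1HolderNorm (ha : IsWeight a)
    (has : IsAsymmetric a)
    (hu : IsDirichletSolution a Ω f g u) {R γ β : ℝ} (hR : 0 < R)
    (hS : UniformExteriorSphere Ω R) (hγ : 0 ≤ γ) (hγa : γ ≤ asymmetryExponent a)
    (hγβ : γ ≤ (1 + β) / 2) (hβ : 0 ≤ β) (hβ1 : β ≤ 1)
    (hg : boundaryC1HolderNorm β Ω g < ∞) :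
    HolderOn γ (closure Ω) u ∧ holderSeminorm γ Ω u ≤
      (holderConstant m (weightMean a) R).toNNReal *
        (boundaryC1HolderNorm β Ω g + linftyNorm Ω f) := by
  set C := (holderConstant m (weightMean a) R).toNNReal
  have hC : (C : ℝ≥0∞) ≠ 0 := by
    rw [ENNReal.coe_ne_zero]
    exact (Real.toNNReal_pos.2 (holderConstant_pos hR)).ne'
  constructor
  · rw [boundaryC1HolderNorm] at hg
    simp only [iInf_lt_iff] at hg
    obtain ⟨G, V, hG, hfin⟩ := hg
    exact (hu.holder_of_isC1Extension ha has hR hS hγ hγa hγβ hβ hβ1 hG hfin).1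
  -- The constant and the norm of `f` are moved to the left, so that the infimum over extensions
  -- stands alone and each extension can be treated separately.
  · rw [mul_comm, ← ENNReal.div_le_iff_le_mul (Or.inl hC) (Or.inl ENNReal.coe_ne_top),
      ← tsub_le_iff_right, boundaryC1HolderNorm]
    refine le_iInf fun G => le_iInf fun V => le_iInf fun hG => ?_
    rcases eq_top_or_lt_top (supNormOn (closure Ω) G + supNormOn (closure Ω) V +
      holderSeminorm β (closure Ω) V) with htop | hfin
    · rw [htop]
      exact le_top
    · rw [tsub_le_iff_right, ENNReal.div_le_iff_le_mul (Or.inl hC) (Or.inl ENNReal.coe_ne_top),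
        mul_comm]
      exact (hu.holder_of_isC1Extension ha has hR hS hγ hγa hγβ hβ hβ1 hG hfin).2

end Estimates

end

theorem mainTheorem8 (m : ℕ) :
    -- general estimate, exterior sphere condition, `g ∈ C^β(∂Ω)`
    (∀ aStar aMean R β : ℝ, 0 < R → 0 < β → β ≤ 1 →
      ∃ C : ℝ≥0, 0 < C ∧
        ∀ (a : Fin (m + 1) → ℝ) (Ω : Set (Rn (m + 1))) (f g u : Rn (m + 1) → ℝ),
          IsWeight a → IsAsymmetric a → weightStar a = aStar → weightMean a = aMean →
          IsDirichletSolution a Ω f g u → UniformExteriorSphere Ω R →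
          HolderOn β (frontier Ω) g →
          HolderOn (min (asymmetryExponent a) (β / 2)) (closure Ω) u ∧
          holderSeminorm (min (asymmetryExponent a) (β / 2)) Ω u ≤
            C * (holderNorm β (frontier Ω) g + linftyNorm Ω f)) ∧
    -- general estimate, in addition Lipschitz boundary, `g ∈ C^{1,β}(∂Ω)`
    (∀ (aStar aMean R β : ℝ) (L : ℝ≥0), 0 < R → 0 ≤ β → β < 1 →
      ∃ C : ℝ≥0, 0 < C ∧
        ∀ (a : Fin (m + 1) → ℝ) (Ω : Set (Rn (m + 1))) (f g u : Rn (m + 1) → ℝ),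
          IsWeight a → IsAsymmetric a → weightStar a = aStar → weightMean a = aMean →
          IsDirichletSolution a Ω f g u → UniformExteriorSphere Ω R →
          UniformLipschitzBoundary Ω L →
          boundaryC1HolderNorm β Ω g < ∞ →
          HolderOn (min (asymmetryExponent a) ((1 + β) / 2)) (closure Ω) u ∧
          holderSeminorm (min (asymmetryExponent a) ((1 + β) / 2)) Ω u ≤
            C * (boundaryC1HolderNorm β Ω g + linftyNorm Ω f)) ∧
    -- exponent `α ∈ (0, 1/2]`, exterior sphere condition, `g ∈ C^{2α}(∂Ω)`
    (∀ aFirst hatFirst aLast hatLast aMean R α : ℝ, 0 < R → 0 < α → α ≤ 1 / 2 →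
      ∃ C : ℝ≥0, 0 < C ∧
        ∀ (a : Fin (m + 1) → ℝ) (Ω : Set (Rn (m + 1))) (f g u : Rn (m + 1) → ℝ),
          IsWeight a → IsAsymmetric a → a 0 = aFirst → weightHat a 0 = hatFirst →
          a (Fin.last m) = aLast → weightHat a (Fin.last m) = hatLast →
          weightMean a = aMean → asymmetryExponent a = α →
          IsDirichletSolution a Ω f g u → UniformExteriorSphere Ω R →
          HolderOn (2 * α) (frontier Ω) g →
          HolderOn α (closure Ω) u ∧
          holderSeminorm α Ω u ≤
            C * (holderNorm (2 * α) (frontier Ω) g + linftyNorm Ω f)) ∧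
    -- exponent `α ∈ [1/2, 1]`, in addition Lipschitz boundary, `g ∈ C^{1,2α-1}(∂Ω)`
    (∀ (aFirst hatFirst aLast hatLast aMean R α : ℝ) (L : ℝ≥0), 0 < R → 1 / 2 ≤ α → α ≤ 1 →
      ∃ C : ℝ≥0, 0 < C ∧
        ∀ (a : Fin (m + 1) → ℝ) (Ω : Set (Rn (m + 1))) (f g u : Rn (m + 1) → ℝ),
          IsWeight a → IsAsymmetric a → a 0 = aFirst → weightHat a 0 = hatFirst →
          a (Fin.last m) = aLast → weightHat a (Fin.last m) = hatLast →
          weightMean a = aMean → asymmetryExponent a = α →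
          IsDirichletSolution a Ω f g u → UniformExteriorSphere Ω R →
          UniformLipschitzBoundary Ω L →
          boundaryC1HolderNorm (2 * α - 1) Ω g < ∞ →
          holderSeminorm α Ω u ≤
            C * (boundaryC1HolderNorm (2 * α - 1) Ω g + linftyNorm Ω f)) := by
  refine ⟨fun _ aMean R β hR hβ hβ1 => ?_, fun _ aMean R β L hR hβ hβ1 => ?_,
    fun _ _ _ _ aMean R α hR hα hα1 => ?_, fun _ _ _ _ aMean R α L hR hα hα1 => ?_⟩ <;>
    refine ⟨(holderConstant m aMean R).toNNReal, Real.toNNReal_pos.2 (holderConstant_pos hR), ?_⟩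
  · rintro a Ω f g u ha has - rfl hu hS hg
    exact hu.holder_of_holderOn ha has hR hS
      (le_min (asymmetryExponent_nonneg ha has) (by positivity)) (min_le_left _ _)
      (min_le_right _ _) hβ hβ1 hg
  · rintro a Ω f g u ha has - rfl hu hS - hg
    exact hu.holder_of_boundaryC1HolderNorm ha has hR hS
      (le_min (asymmetryExponent_nonneg ha has) (by positivity)) (min_le_left _ _)
      (min_le_right _ _) hβ hβ1.le hg
  -- The last two parts take `β = 2α` and `β = 2α - 1`, so that `β/2`, respectively `(1 + β)/2`,
  -- equals `α`. For `α = 1` this is the endpoint `β = 1`.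
  · rintro a Ω f g u ha has - - - - rfl hae hu hS hg
    exact hu.holder_of_holderOn ha has hR hS hα.le hae.ge (by linarith) (by linarith)
      (by linarith) hg
  · rintro a Ω f g u ha has - - - - rfl hae hu hS - hg
    exact (hu.holder_of_boundaryC1HolderNorm ha has hR hS (by linarith) hae.ge (by linarith)
      (by linarith) (by linarith) hg).2
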